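/- Let $p$ be a prime, let $s$ be a positive integer, and let $\mathbb F_q$ be a finite field of order $q=p^s$. For an integer $m\ge 0$ let $\sigma_p(m)$ be the sum of the digits of $m$ in base $p$ (so $\sigma_p(0)=0$). For a nonempty subset $\mathcal I\subseteq\{1,\dots,n\}$ and a nonzero polynomial $P\in\mathbb F_q[t_1,\dots,t_n]$, let $w_{p,\mathcal I}(P)$ be the maximum of $\sum_{i\in\mathcal I}\sigma_p(m_i)$ over all monomials $t_1^{m_1}\cdots t_n^{m_n}$ that occur in $P$ with nonzero coefficient. For a nonzero univariate polynomial $f\in\mathbb F_q[t]$, let $w_p(f)$ be the maximum of $\sigma_p(m)$ over all $m$ such that $t^m$ occurs in $f$ with nonzero coefficient. Theorem. Let $P_1,\dots,P_r\in\mathbb F_q[t_1,\dots,t_n]$ be nonzero polynomials, and let $\mathcal I\subseteq\{1,\dots,n\}$ be a nonempty subset such that $\max_{1\le j\le r}w_{p,\mathcal I}(P_j)>0$. Let $f_1,\dots,f_n\in\mathbb F_q[t]$, and assume that $f_i$ is nonconstant for all $i\in\mathcal I$. Suppose that $$\sum_{j=1}^r w_{p,\mathcal I}(P_j)\le\sum_{i\in\mathcal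 I}\frac1{w_p(f_i)}.$$ Then $$p^{\left\lceil s\left(\sum_{i\in\mathcal I}\frac1{w_p(f_i)}-\sum_{j=1}^r w_{p,\mathcal I}(P_j)\right)\big/\max_{1\le j\le r}w_{p,\mathcal I}(P_j)\right\rceil}$$ divides $$\#\{(x_1,\dots,x_n)\in\mathbb F_q^n \mid P_j(f_1(x_1),\dots,f_n(x_n))=0\text{ for all }1\le j\le r\}.$$ -/

import Mathlib

/-- The sum of the digits of `M` in base `N` (used for `N ≥ 2`; the digit sum of `0` is `0`). -/
def digitSum (N M : ℕ) : ℕ := (Nat.digits N M).sum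

/-- The `p`-weight degree of a multivariate polynomial with respect to a set `I` of variables:
the maximum, over the monomials `t ^ m` that occur in `P`, of `∑ i ∈ I, digitSum p (m i)`.
The value at `P = 0` is the default `0`. -/
def pWeightDegree {n : ℕ} {F : Type*} [CommSemiring F] (p : ℕ) (I : Finset (Fin n))
    (P : MvPolynomial (Fin n) F) : ℕ :=
  P.support.sup fun m => ∑ i ∈ I, digitSum p (m i)

/-- The `p`-weight degree of a univariate polynomial: the maximum of `digitSum p m` over the
monomials `t ^ m` that occur in `f`. The value at `f = 0` is the default `0`. -/
def pWeightDegreeUni {F : Type*} [Semiring F] (p : ℕ) (f : Polynomial F) : ℕ :=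
  f.support.sup fun m => digitSum p m

/-- The maximum over `j` of the `p`-weight degrees of `P j` with respect to `I`. -/
def maxPWeightDegree {n r : ℕ} {F : Type*} [CommSemiring F] (p : ℕ) (I : Finset (Fin n))
    (P : Fin r → MvPolynomial (Fin n) F) : ℕ :=
  Finset.univ.sup fun j => pWeightDegree p I (P j)

/-- The solutions `x` in `F ^ n` of the system `P_j (f_1 (x_1), …, f_n (x_n)) = 0` for all `j`. -/
def substSolutions {n r : ℕ} {F : Type*} [CommSemiring F]
    (P : Fin r → MvPolynomial (Fin n) F) (f : Fin n → Polynomial F) : Set (Fin n → F) :=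
  {x | ∀ j, MvPolynomial.eval (fun i => (f i).eval (x i)) (P j) = 0}

/-! In a basis of F over F_p, each equation becomes s equations over F_p. Lift their left sides to
functions v_t with values in ℕ. Expand the indicator of p ∣ z as ∑ c_k (z choose k), where c_k gains
a factor p for every p - 1 steps in k (`pow_dvd_fleckCoeff`). The count is then a sum over κ of ∏
c_{κ_t} · ∑_x ∏ (v_t(x) choose κ_t), and it suffices to bound the p-divisibility of each term.

The inner sums are controlled by a filtration of integer-valued functions: summing a function of
degree d over F^n gives a multiple of p to the power s ∑ 1/w_i - d/(p-1), rounded up, with w_i the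
weight of f_i (`dvd_sum_of_mem_boxFiltration`). Requiring all binomials of v_t to have controlled
degree is stable under sums and products (`Good.mul`). Frobenius is linear over F_p and hence free,
so an m-th power costs only the digit sum of m (`FrobLift.pow`). Balancing the two sources of p
gives the exponent. -/

/-- A multiplicative increasing filtration of the ring of integer-valued functions on `X`. -/
structure MulFiltration (X : Type*) where
  toFun : ℕ → Submodule ℤ (X → ℤ)
  mono : Monotone toFun
  one_mem : (1 : X → ℤ) ∈ toFun 0
  mul_mem : ∀ {a b : ℕ} {u v : X → ℤ}, u ∈ toFun a → v ∈ toFun b → u * v ∈ toFun (a + b)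

/-! ### Functions whose binomials have controlled degree -/

namespace MulFiltration

variable {X : Type*} (W : MulFiltration X)

theorem one_mem' (d : ℕ) : (1 : X → ℤ) ∈ W.toFun d := W.mono (Nat.zero_le d) W.one_mem

theorem prod_mem {κ : Type*} (s : Finset κ) (d : κ → ℕ) (u : κ → X → ℤ)
    (h : ∀ t ∈ s, u t ∈ W.toFun (d t)) : ∏ t ∈ s, u t ∈ W.toFun (∑ t ∈ s, d t) := by
  classical
  induction s using Finset.induction_on with
  | empty => simpa using W.one_mem
  | insert a s ha ih =>
    rw [Finset.prod_insert ha, Finset.sum_insert ha]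
    exact W.mul_mem (h a (by simp)) (ih fun t ht => h t (by simp [ht]))

/-- The polynomial-valued functions whose `k`-th coefficient lies in filtration degree `k * d`. -/
def Rees (d : ℕ) (q : X → Polynomial ℤ) : Prop :=
  ∀ k, (fun x => (q x).coeff k) ∈ W.toFun (k * d)

/-- The functions `u` all of whose binomials `u.choose k` lie in filtration degree `k * d`. -/
def Good (d : ℕ) (u : X → ℕ) : Prop :=
  ∀ k, (fun x => ((u x).choose k : ℤ)) ∈ W.toFun (k * d)

variable {W}

theorem Rees.one (d : ℕ) : W.Rees d (fun _ => 1) := by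
  intro k
  rcases k with _ | k
  · simpa [Pi.one_def] using W.one_mem
  · simp only [Polynomial.coeff_one, Nat.succ_ne_zero, if_false]
    exact Submodule.zero_mem _

theorem Rees.mul {d : ℕ} {q r : X → Polynomial ℤ} (hq : W.Rees d q) (hr : W.Rees d r) :
    W.Rees d (fun x => q x * r x) := by
  intro k
  have : (fun x => (q x * r x).coeff k) = ∑ ij ∈ Finset.HasAntidiagonal.antidiagonal k,
      (fun x => (q x).coeff ij.1) * (fun x => (r x).coeff ij.2) := by
    ext x
    simp [Polynomial.coeff_mul]
  rw [this]
  refine Submodule.sum_mem _ fun ij hij => ?_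
  rw [← Finset.HasAntidiagonal.mem_antidiagonal.1 hij, add_mul]
  exact W.mul_mem (hq _) (hr _)

theorem Rees.pow {d : ℕ} {q : X → Polynomial ℤ} (hq : W.Rees d q) (n : ℕ) :
    W.Rees d (fun x => q x ^ n) := by
  induction n with
  | zero => simpa using Rees.one d
  | succ n ih => simpa only [pow_succ] using ih.mul hq

theorem Rees.sub {d : ℕ} {q r : X → Polynomial ℤ} (hq : W.Rees d q) (hr : W.Rees d r) :
    W.Rees d (fun x => q x - r x) := by
  intro k
  simp only [Polynomial.coeff_sub]
  exact Submodule.sub_mem _ (hq k) (hr k)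

/-- Packing the binomials into (1 + X)^u turns sums of functions into products in the Rees algebra.
-/
theorem good_iff_rees {d : ℕ} {u : X → ℕ} :
    W.Good d u ↔ W.Rees d (fun x => (1 + Polynomial.X) ^ u x) := by
  simp [Good, Rees, Polynomial.coeff_one_add_X_pow]

theorem Good.mono {a b : ℕ} (hab : a ≤ b) {u : X → ℕ} (h : W.Good a u) : W.Good b u :=
  fun k => W.mono (Nat.mul_le_mul_left k hab) (h k)

theorem Good.const (d c : ℕ) : W.Good d (fun _ : X => c) := by
  intro k
  have : (fun _ : X => (c.choose k : ℤ)) = (c.choose k : ℤ) • (1 : X → ℤ) := by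
    ext; simp
  rw [this]
  exact Submodule.smul_mem _ _ (W.one_mem' _)

theorem Good.add {d : ℕ} {u v : X → ℕ} (hu : W.Good d u) (hv : W.Good d v) :
    W.Good d (fun x => u x + v x) := by
  rw [good_iff_rees] at *
  simpa only [pow_add] using hu.mul hv

theorem Good.sum {κ : Type*} (s : Finset κ) {d : ℕ} {u : κ → X → ℕ}
    (h : ∀ t ∈ s, W.Good d (u t)) : W.Good d (fun x => ∑ t ∈ s, u t x) := by
  classical
  induction s using Finset.induction_on with
  | empty => simpa using Good.const d 0
  | insert a s ha ih =>
    simp only [Finset.sum_insert ha]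
    exact (h a (by simp)).add (ih fun t ht => h t (by simp [ht]))

/-- Expand (1 + X)^(uv) = (((1 + X)^u - 1) + 1)^v binomially. Since X divides (1 + X)^u - 1, only j
≤ k contributes to the coefficient of X^k, and the j-th term has degree at most j b + k a. -/
theorem Good.mul {a b : ℕ} {u v : X → ℕ} (hu : W.Good a u) (hv : W.Good b v) :
    W.Good (a + b) (fun x => u x * v x) := by
  have hr := (good_iff_rees.1 hu).sub (Rees.one a)
  intro k
  have key : (fun x => ((u x * v x).choose k : ℤ)) = ∑ j ∈ Finset.range (k + 1),
      (fun x => ((v x).choose j : ℤ)) *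
        (fun x => (((1 + Polynomial.X : Polynomial ℤ) ^ u x - 1) ^ j).coeff k) := by
    ext x
    have hX : (Polynomial.X : Polynomial ℤ) ∣ (1 + Polynomial.X) ^ u x - 1 := by
      rw [Polynomial.X_dvd_iff]
      simp [Polynomial.coeff_one_add_X_pow]
    have hzero : ∀ j, k < j →
        (((1 + Polynomial.X : Polynomial ℤ) ^ u x - 1) ^ j).coeff k = 0 := fun j hj =>
      (Polynomial.X_pow_dvd_iff.1 (pow_dvd_pow_of_dvd hX j)) k hj
    have h1 : ((u x * v x).choose k : ℤ) =
        (((1 + Polynomial.X : Polynomial ℤ) ^ u x - 1 + 1) ^ v x).coeff k := by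
      rw [sub_add_cancel, ← pow_mul, Polynomial.coeff_one_add_X_pow]
    have h2 : ((u x * v x).choose k : ℤ) = ∑ j ∈ Finset.range (v x + 1), ((v x).choose j : ℤ) *
        (((1 + Polynomial.X : Polynomial ℤ) ^ u x - 1) ^ j).coeff k := by
      rw [h1, add_pow, Polynomial.finsetSum_coeff]
      refine Finset.sum_congr rfl fun j _ => ?_
      rw [one_pow, mul_one, Polynomial.coeff_mul_natCast, mul_comm]
    rw [h2]
    simp only [Finset.sum_apply, Pi.mul_apply]
    rcases le_total (v x) k with h | h
    · refine Finset.sum_subset (fun j hj => by simp at hj ⊢; omega) fun j _ hj => ?_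
      rw [Nat.choose_eq_zero_of_lt (by simpa using hj)]
      simp
    · refine (Finset.sum_subset (fun j hj => by simp at hj ⊢; omega) fun j _ hj => ?_).symm
      rw [hzero j (by simpa using hj), mul_zero]
  rw [key]
  refine Submodule.sum_mem _ fun j hj => ?_
  have hjk : j ≤ k := by simpa [Nat.lt_succ_iff] using hj
  refine W.mono ?_ (W.mul_mem (hv j) (hr.pow j k))
  nlinarith [Nat.mul_le_mul_right b hjk]

end MulFiltration

/-! ### Lifting coordinates of F-valued functions, and digit sums -/

section Lift

variable {X F β : Type*} {p : ℕ} [Fact p.Prime] [Field F] [Algebra (ZMod p) F]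

/-- The functions to `F` all of whose coordinates in the basis `B` lift to natural-number valued
functions that are good of degree `d`. -/
def CoordLift (B : Module.Basis β (ZMod p) F) (W : MulFiltration X) (d : ℕ) (u : X → F) : Prop :=
  ∀ a, ∃ v : X → ℕ, (∀ x, (v x : ZMod p) = B.repr (u x) a) ∧ W.Good d v

variable {B : Module.Basis β (ZMod p) F} {W : MulFiltration X}

theorem CoordLift.mono {a b : ℕ} (hab : a ≤ b) {u : X → F} (h : CoordLift B W a u) :
    CoordLift B W b u := fun i => let ⟨v, hv, hg⟩ := h i; ⟨v, hv, hg.mono hab⟩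

theorem CoordLift.const (d : ℕ) (c : F) : CoordLift B W d (fun _ => c) := fun a =>
  ⟨fun _ => (B.repr c a).val, fun _ => ZMod.natCast_zmod_val _, MulFiltration.Good.const _ _⟩

theorem CoordLift.add {d : ℕ} {u v : X → F} (hu : CoordLift B W d u) (hv : CoordLift B W d v) :
    CoordLift B W d (fun x => u x + v x) := by
  intro a
  obtain ⟨u', hu', gu⟩ := hu a
  obtain ⟨v', hv', gv⟩ := hv a
  exact ⟨_, fun x => by simp [hu', hv'], gu.add gv⟩

/-- Multiplication is bilinear in coordinates; its structure constants lift to constants, which have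
degree 0. -/
theorem CoordLift.mul [Fintype β] {c d : ℕ} {u v : X → F} (hu : CoordLift B W c u) (hv : CoordLift B W d v) :
    CoordLift B W (c + d) (fun x => u x * v x) := by
  intro a
  choose u' hu' gu using hu
  choose v' hv' gv using hv
  refine ⟨fun x => ∑ i, ∑ j, u' i x * v' j x * (B.repr (B i * B j) a).val, fun x => ?_,
    .sum _ fun i _ => .sum _ fun j _ => by
      simpa using ((gu i).mul (gv j)).mul (.const 0 (B.repr (B i * B j) a).val)⟩
  change _ = B.repr (u x * v x) a
  conv_rhs => rw [← B.sum_repr (u x), ← B.sum_repr (v x), Finset.sum_mul_sum]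
  simp only [Nat.cast_sum, Nat.cast_mul, hu', hv', ZMod.natCast_zmod_val, smul_mul_smul_comm,
    map_sum, map_smul, Finsupp.finsetSum_apply, Finsupp.smul_apply, smul_eq_mul]

/-- The functions to `F` all of whose Frobenius twists satisfy `CoordLift`. -/
def FrobLift (B : Module.Basis β (ZMod p) F) (W : MulFiltration X) (d : ℕ) (u : X → F) : Prop :=
  ∀ e, CoordLift B W d (fun x => u x ^ p ^ e)

theorem FrobLift.coordLift {d : ℕ} {u : X → F} (h : FrobLift B W d u) : CoordLift B W d u := by
  simpa using h 0

theorem FrobLift.mono {a b : ℕ} (hab : a ≤ b) {u : X → F} (h : FrobLift B W a u) :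
    FrobLift B W b u := fun e => (h e).mono hab

theorem FrobLift.const (d : ℕ) (c : F) : FrobLift B W d (fun _ => c) := fun _ => .const _ _

theorem FrobLift.add {d : ℕ} {u v : X → F} (hu : FrobLift B W d u) (hv : FrobLift B W d v) :
    FrobLift B W d (fun x => u x + v x) := by
  have : CharP F p := charP_of_injective_algebraMap (algebraMap (ZMod p) F).injective p
  intro e
  simpa only [add_pow_char_pow] using (hu e).add (hv e)

theorem FrobLift.mul [Fintype β] {c d : ℕ} {u v : X → F} (hu : FrobLift B W c u) (hv : FrobLift B W d v) :
    FrobLift B W (c + d) (fun x => u x * v x) := by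
  intro e
  simpa only [mul_pow] using (hu e).mul (hv e)

theorem FrobLift.sum {κ : Type*} (s : Finset κ) {d : ℕ} {u : κ → X → F}
    (h : ∀ t ∈ s, FrobLift B W d (u t)) : FrobLift B W d (fun x => ∑ t ∈ s, u t x) := by
  classical
  induction s using Finset.induction_on with
  | empty => simpa using FrobLift.const d 0
  | insert a s ha ih =>
    simp only [Finset.sum_insert ha]
    exact (h a (by simp)).add (ih fun t ht => h t (by simp [ht]))

theorem FrobLift.prod [Fintype β] {κ : Type*} (s : Finset κ) {d : κ → ℕ} {u : κ → X → F}
    (h : ∀ t ∈ s, FrobLift B W (d t) (u t)) :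
    FrobLift B W (∑ t ∈ s, d t) (fun x => ∏ t ∈ s, u t x) := by
  classical
  induction s using Finset.induction_on with
  | empty => simpa using FrobLift.const 0 1
  | insert a s ha ih =>
    simp only [Finset.prod_insert ha, Finset.sum_insert ha]
    exact (h a (by simp)).mul (ih fun t ht => h t (by simp [ht]))

theorem FrobLift.smallPow [Fintype β] {d : ℕ} {u : X → F} (h : FrobLift B W d u) (m : ℕ) :
    FrobLift B W (m * d) (fun x => u x ^ m) := by
  simpa using FrobLift.prod (Finset.range m) (fun _ _ => h)

theorem FrobLift.frobenius {d : ℕ} {u : X → F} (h : FrobLift B W d u) :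
    FrobLift B W d (fun x => u x ^ p) := by
  intro e
  simpa only [← pow_mul, ← pow_succ'] using h (e + 1)

theorem digitSum_eq_mod_add {p m : ℕ} (hp : 1 < p) (hm : 0 < m) :
    digitSum p m = m % p + digitSum p (m / p) := by
  simp [digitSum, Nat.digits_def' hp hm]

theorem digitSum_pos {p m : ℕ} (hp : 1 < p) (hm : 0 < m) : 0 < digitSum p m := by
  induction m using Nat.strong_induction_on with
  | _ m ih =>
    rw [digitSum_eq_mod_add hp hm]
    rcases Nat.eq_zero_or_pos (m % p) with h | h
    · have := ih (m / p) (Nat.div_lt_self hm hp)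
        (Nat.div_pos (Nat.le_of_dvd hm (Nat.dvd_of_mod_eq_zero h)) (by omega))
      omega
    · omega

/-- Taking the `m`-th power multiplies the degree by the digit sum of `m`. -/
theorem FrobLift.pow [Fintype β] (m : ℕ) {d : ℕ} {u : X → F} (h : FrobLift B W d u) :
    FrobLift B W (digitSum p m * d) (fun x => u x ^ m) := by
  have hp : 1 < p := (Fact.out : p.Prime).one_lt
  induction m using Nat.strong_induction_on generalizing u with
  | _ m ih =>
    rcases Nat.eq_zero_or_pos m with rfl | hm
    · simpa using FrobLift.const _ 1
    · have := (h.smallPow (m % p)).mul (ih (m / p) (Nat.div_lt_self hm hp) h.frobenius)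
      simpa only [← pow_mul, ← pow_add, Nat.mod_add_div, ← add_mul, ← digitSum_eq_mod_add hp hm]
        using this

end Lift

/-! ### The indicator of multiples of p in binomial coefficients -/

section Fleck

/-- The coefficients of the expansion of the indicator function of the multiples of `p` in
binomial coefficients. -/
noncomputable def fleckCoeff (p k : ℕ) : ℤ :=
  ((AddMonoidAlgebra.single (1 : ZMod p) (1 : ℤ) - 1) ^ k).coeff 0

/-- In the group ring of ℤ/p, expand g^z = ((g - 1) + 1)^z and read off the coefficient at the
identity. -/
theorem sum_fleckCoeff_mul_choose (p z : ℕ) {N : ℕ} (hz : z < N) :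
    ∑ k ∈ Finset.range N, fleckCoeff p k * z.choose k = if (z : ZMod p) = 0 then 1 else 0 := by
  have h1 : (AddMonoidAlgebra.single (1 : ZMod p) (1 : ℤ)) ^ z =
      ∑ k ∈ Finset.range (z + 1),
        (z.choose k) • (AddMonoidAlgebra.single (1 : ZMod p) (1 : ℤ) - 1) ^ k := by
    conv_lhs => rw [← sub_add_cancel (AddMonoidAlgebra.single (1 : ZMod p) (1 : ℤ)) 1, add_pow]
    simp [nsmul_eq_mul, mul_comm]
  have h2 := congrArg (fun r : AddMonoidAlgebra ℤ (ZMod p) => r.coeff 0) h1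
  simp only [AddMonoidAlgebra.single_pow, one_pow, nsmul_eq_mul, mul_one,
    AddMonoidAlgebra.coeff_single, Finsupp.single_apply] at h2
  rw [h2, AddMonoidAlgebra.coeff_sum, Finsupp.finsetSum_apply]
  refine (Finset.sum_subset (fun j hj => by simp at hj ⊢; omega) fun j _ hj => ?_).symm.trans
    (Finset.sum_congr rfl fun k _ => ?_)
  · rw [Nat.choose_eq_zero_of_lt (by simpa using hj)]
    simp
  · rw [← nsmul_eq_mul, AddMonoidAlgebra.coeff_smul]
    simp [fleckCoeff, mul_comm]

/-- With t = g - 1, the relation (t + 1)^p = 1 makes t^p a multiple of p t, so p - 1 further powers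
of t yield one more factor p. -/
theorem pow_dvd_fleckCoeff {p : ℕ} (hp : p.Prime) (m k : ℕ) (h : m * (p - 1) < k) :
    (p : ℤ) ^ m ∣ fleckCoeff p k := by
  set t : AddMonoidAlgebra ℤ (ZMod p) := AddMonoidAlgebra.single (1 : ZMod p) (1 : ℤ) - 1 with ht
  have h1 : (t + 1) ^ p = 1 := by
    rw [ht, sub_add_cancel, AddMonoidAlgebra.single_pow]
    simp [AddMonoidAlgebra.one_def]
  obtain ⟨r, hr⟩ := exists_add_pow_prime_eq hp t 1
  have h2 : t ^ p = (p : AddMonoidAlgebra ℤ (ZMod p)) * (t * -r) := by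
    rw [h1] at hr
    linear_combination -hr
  have key : ∀ m, (p : AddMonoidAlgebra ℤ (ZMod p)) ^ m ∣ t ^ (m * (p - 1) + 1) := by
    intro m
    induction m with
    | zero => simp
    | succ m ih =>
      have hp1 := hp.one_lt
      have : (m + 1) * (p - 1) + 1 = m * (p - 1) + p := by
        rw [add_mul, one_mul]; omega
      rw [this, pow_add t, h2]
      obtain ⟨w, hw⟩ := ih
      exact ⟨w * -r, by rw [pow_succ] at hw ⊢; linear_combination (-p * r) * hw⟩
  obtain ⟨w, hw⟩ := (key m).trans (pow_dvd_pow t h)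
  refine ⟨w.coeff 0, ?_⟩
  have : t ^ k = (p ^ m : ℤ) • w := by
    rw [hw]; simp
  rw [fleckCoeff, ← ht, this, AddMonoidAlgebra.coeff_smul]
  simp

end Fleck

/-! ### Functions of one coordinate in ℤ/p -/

section Coordinate

variable (p : ℕ) [Fact p.Prime]

/-- The integer-valued functions on `ZMod p` whose reduction is a polynomial of degree
at most `k`. -/
def PolyMod (k : ℕ) (h : ZMod p → ℤ) : Prop :=
  ∃ P : Polynomial (ZMod p), P.natDegree ≤ k ∧ ∀ x, (h x : ZMod p) = P.eval x

variable {p}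

theorem PolyMod.one (k : ℕ) : PolyMod p k 1 := ⟨1, by simp, by simp⟩

theorem PolyMod.mul {k l : ℕ} {g h : ZMod p → ℤ} (hg : PolyMod p k g) (hh : PolyMod p l h) :
    PolyMod p (k + l) (g * h) := by
  obtain ⟨P, hP, eP⟩ := hg
  obtain ⟨Q, hQ, eQ⟩ := hh
  exact ⟨P * Q, Polynomial.natDegree_mul_le_of_le hP hQ, by simp [eP, eQ]⟩

/-- For k < p, k! is invertible mod p; for k ≥ p the binomial vanishes on representatives below p.
-/
theorem PolyMod.choose (k : ℕ) : PolyMod p k (fun x => (x.val.choose k : ℤ)) := by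
  rcases lt_or_ge k p with hk | hk
  · refine ⟨Polynomial.C ((k.factorial : ZMod p)⁻¹) * descPochhammer (ZMod p) k,
      (Polynomial.natDegree_C_mul_le _ _).trans (descPochhammer_natDegree _ _).le, fun x => ?_⟩
    have h0 : (k.factorial : ZMod p) ≠ 0 := by
      rw [Ne, ZMod.natCast_eq_zero_iff, (Fact.out : p.Prime).dvd_factorial]
      omega
    have h1 := descPochhammer_eval_eq_descFactorial (ZMod p) x.val k
    rw [ZMod.natCast_zmod_val, Nat.descFactorial_eq_factorial_mul_choose] at h1
    rw [Polynomial.eval_mul, Polynomial.eval_C, h1]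
    push_cast
    field_simp
  · refine ⟨0, by simp, fun x => ?_⟩
    beta_reduce
    rw [Nat.choose_eq_zero_of_lt ((ZMod.val_lt x).trans_le hk)]
    simp

theorem PolyMod.dvd_sum {k : ℕ} {h : ZMod p → ℤ} (hh : PolyMod p k h) (hk : k < p - 1) :
    (p : ℤ) ∣ ∑ x, h x := by
  obtain ⟨P, hP, eP⟩ := hh
  rw [← ZMod.intCast_zmod_eq_zero_iff_dvd]
  push_cast
  simp only [eP, Polynomial.eval_eq_sum_range]
  rw [Finset.sum_comm]
  refine Finset.sum_eq_zero fun i hi => ?_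
  rw [← Finset.mul_sum, FiniteField.sum_pow_lt_card_sub_one, mul_zero]
  rw [ZMod.card]
  simp at hi
  omega

end Coordinate

/-! ### Degree in coordinates on F -/

section FieldFiltration

variable {F β : Type*} {p : ℕ} [Fact p.Prime] [Field F] [Algebra (ZMod p) F] [Fintype β]

/-- Products over the coordinates of functions of one coordinate, of total degree at most `d`. -/
def coordProducts (B : Module.Basis β (ZMod p) F) (d : ℕ) : Set (F → ℤ) :=
  {u | ∃ (k : β → ℕ) (h : β → ZMod p → ℤ), ∑ b, k b ≤ d ∧ (∀ b, PolyMod p (k b) (h b)) ∧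
    ∀ y, u y = ∏ b, h b (B.repr y b)}

/-- The filtration on functions on `F` by degree in the coordinates. -/
def coordFiltration (B : Module.Basis β (ZMod p) F) : MulFiltration F where
  toFun d := Submodule.span ℤ (coordProducts B d)
  mono a b hab := Submodule.span_mono fun _ ⟨k, h, hk, hh, hu⟩ => ⟨k, h, hk.trans hab, hh, hu⟩
  one_mem := Submodule.subset_span ⟨0, fun _ => 1, by simp, fun _ => .one _, by simp⟩
  mul_mem {a b u v} hu hv := by
    have := Submodule.mul_mem_mul hu hv
    rw [Submodule.span_mul_span] at this
    refine Submodule.span_mono ?_ this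
    rintro _ ⟨u, ⟨k, h, hk, hh, hu⟩, v, ⟨l, g, hl, hg, hv⟩, rfl⟩
    exact ⟨k + l, h * g, by simpa [Finset.sum_add_distrib] using add_le_add hk hl,
      fun b => (hh b).mul (hg b), fun y => by simp [hu, hv, Finset.prod_mul_distrib]⟩

theorem dvd_sum_of_mem_coordFiltration [Fintype F] (B : Module.Basis β (ZMod p) F) {d : ℕ}
    {u : F → ℤ} (hu : u ∈ (coordFiltration B).toFun d) :
    (p : ℤ) ^ (Fintype.card β - d / (p - 1)) ∣ ∑ y, u y := by
  classical
  induction hu using Submodule.span_induction with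
  | zero => simp
  | add u v _ _ hu hv => simpa [Finset.sum_add_distrib] using dvd_add hu hv
  | smul c u _ hu => simpa [← Finset.mul_sum] using hu.mul_left c
  | mem u hu =>
    obtain ⟨k, h, hk, hh, hu⟩ := hu
    have h1 : ∑ y, u y = ∏ b, ∑ x, h b x := by
      rw [Finset.prod_univ_sum, Fintype.piFinset_univ]
      exact Fintype.sum_equiv B.equivFun.toEquiv _ _ (by simp [hu])
    rw [h1]
    set S := Finset.univ.filter fun b => k b < p - 1 with hS
    have h2 : (p : ℤ) ^ S.card ∣ ∏ b, ∑ x, h b x := by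
      refine dvd_trans ?_ (Finset.prod_dvd_prod_of_subset S _ _ (Finset.subset_univ S))
      rw [← Finset.prod_const]
      exact Finset.prod_dvd_prod_of_dvd _ _ fun b hb =>
        (hh b).dvd_sum (Finset.mem_filter.1 hb).2
    refine (pow_dvd_pow _ ?_).trans h2
    -- Each coordinate that yields no factor p uses up at least p - 1 of the degree d.
    have h3 : (Finset.univ.filter fun b => ¬ k b < p - 1).card * (p - 1) ≤ d := by
      refine le_trans ?_ hk
      refine le_trans ?_ (Finset.sum_le_sum_of_subset
        (Finset.subset_univ (Finset.univ.filter fun b => ¬ k b < p - 1)))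
      rw [← smul_eq_mul]
      exact Finset.card_nsmul_le_sum _ _ _ fun b hb => not_lt.1 (Finset.mem_filter.1 hb).2
    have h4 := Finset.card_filter_add_card_filter_not (s := (Finset.univ : Finset β))
      (fun b => k b < p - 1)
    have hp := (Fact.out : p.Prime).two_le
    have h5 := (Nat.le_div_iff_mul_le (by omega : 0 < p - 1)).2 h3
    rw [Finset.card_univ, ← hS] at h4
    omega

theorem good_coord [DecidableEq β] (B : Module.Basis β (ZMod p) F) (b : β) :
    (coordFiltration B).Good 1 (fun y => (B.repr y b).val) := by
  intro k
  refine Submodule.subset_span ⟨Pi.single b k,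
    Pi.mulSingle b (fun x => (x.val.choose k : ℤ)), by simp, fun c => ?_, fun y => ?_⟩
  · rcases eq_or_ne c b with rfl | h
    · simpa using PolyMod.choose k
    · simpa [h] using PolyMod.one 0
  · rw [Finset.prod_eq_single b]
    · simp
    · intro c _ h
      simp [h]
    · simp

/-- Every Frobenius power is F_p-linear, so its coordinates are linear forms in those of y. -/
theorem frobLift_id (B : Module.Basis β (ZMod p) F) :
    FrobLift B (coordFiltration B) 1 (fun y => y) := by
  classical
  have : CharP F p := charP_of_injective_algebraMap (algebraMap (ZMod p) F).injective p
  intro e a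
  refine ⟨fun y => ∑ b, (B.repr y b).val * (B.repr (B b ^ p ^ e) a).val, fun y => ?_,
    .sum _ fun b _ => by simpa using (good_coord B b).mul (.const 0 _)⟩
  change _ = B.repr (y ^ p ^ e) a
  conv_rhs => rw [← B.sum_repr y, sum_pow_char_pow]
  simp [smul_pow, ZMod.pow_card_pow]

theorem frobLift_eval (B : Module.Basis β (ZMod p) F) (f : Polynomial F) :
    FrobLift B (coordFiltration B) (pWeightDegreeUni p f) (fun y => f.eval y) := by
  simp only [Polynomial.eval_eq_sum, Polynomial.sum]
  refine .sum _ fun m hm => ?_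
  refine .mono ?_ ((FrobLift.const 0 (f.coeff m)).mul ((frobLift_id B).pow m))
  simpa [pWeightDegreeUni] using Finset.le_sup (f := fun m => digitSum p m) hm

end FieldFiltration

/-! ### Weighted degree on F^n -/

section BoxFiltration

variable {F β : Type*} {p n : ℕ} [Fact p.Prime] [Field F] [Algebra (ZMod p) F] [Fintype β]

/-- Products of functions of one variable, where the variable `i ∈ I` has weight `1 / w i` and
the variables outside `I` have weight `0`, of total weighted degree at most `d`. -/
def boxProducts (B : Module.Basis β (ZMod p) F) (I : Finset (Fin n)) (w : Fin n → ℕ) (d : ℕ) :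
    Set ((Fin n → F) → ℤ) :=
  {u | ∃ (l : Fin n → ℕ) (g : Fin n → F → ℤ), ∑ i ∈ I, l i ≤ d ∧
    (∀ i ∈ I, g i ∈ (coordFiltration B).toFun (l i * w i)) ∧
    (∀ i ∉ I, ∃ e, g i ∈ (coordFiltration B).toFun e) ∧ ∀ x, u x = ∏ i, g i (x i)}

/-- The filtration on functions on `F ^ n` by weighted degree. -/
def boxFiltration (B : Module.Basis β (ZMod p) F) (I : Finset (Fin n)) (w : Fin n → ℕ) :
    MulFiltration (Fin n → F) where
  toFun d := Submodule.span ℤ (boxProducts B I w d)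
  mono a b hab := Submodule.span_mono fun _ ⟨l, g, hl, h⟩ => ⟨l, g, hl.trans hab, h⟩
  one_mem := Submodule.subset_span ⟨0, fun _ => 1, by simp, fun _ _ => MulFiltration.one_mem' _ _,
    fun _ _ => ⟨0, MulFiltration.one_mem _⟩, by simp⟩
  mul_mem {a b u v} hu hv := by
    have := Submodule.mul_mem_mul hu hv
    rw [Submodule.span_mul_span] at this
    refine Submodule.span_mono ?_ this
    rintro _ ⟨u, ⟨l, g, hl, hg, hg', hu⟩, v, ⟨m, h, hm, hh, hh', hv⟩, rfl⟩
    refine ⟨l + m, g * h, by simpa [Finset.sum_add_distrib] using add_le_add hl hm,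
      fun i hi => ?_, fun i hi => ?_, fun y => by simp [hu, hv, Finset.prod_mul_distrib]⟩
    · simpa [add_mul] using MulFiltration.mul_mem _ (hg i hi) (hh i hi)
    · obtain ⟨c, hc⟩ := hg' i hi
      obtain ⟨d, hd⟩ := hh' i hi
      exact ⟨_, MulFiltration.mul_mem _ hc hd⟩

variable {B : Module.Basis β (ZMod p) F} {I : Finset (Fin n)} {w : Fin n → ℕ}

theorem good_box_of_mem {i : Fin n} (hi : i ∈ I) {v : F → ℕ}
    (hv : (coordFiltration B).Good (w i) v) : (boxFiltration B I w).Good 1 (fun x => v (x i)) := by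
  intro k
  refine Submodule.subset_span ⟨Pi.single i k,
    Pi.mulSingle i (fun y => ((v y).choose k : ℤ)), by simp [hi], fun c _ => ?_,
    fun c hc => ⟨0, ?_⟩, fun x => ?_⟩
  · rcases eq_or_ne c i with rfl | h
    · simpa using hv k
    · simpa [h] using (coordFiltration B).one_mem
  · have h : c ≠ i := fun h => hc (h ▸ hi)
    simpa [h] using (coordFiltration B).one_mem
  · rw [Finset.prod_eq_single i]
    · simp
    · intro c _ h
      simp [h]
    · simp

theorem good_box_of_notMem {i : Fin n} (hi : i ∉ I) {d : ℕ} {v : F → ℕ}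
    (hv : (coordFiltration B).Good d v) : (boxFiltration B I w).Good 0 (fun x => v (x i)) := by
  intro k
  refine Submodule.subset_span ⟨0,
    Pi.mulSingle i (fun y => ((v y).choose k : ℤ)), by simp, fun c hc => ?_,
    fun c hc => ?_, fun x => ?_⟩
  · have h : c ≠ i := fun h => hi (h ▸ hc)
    simpa [h] using (coordFiltration B).one_mem
  · rcases eq_or_ne c i with rfl | h
    · exact ⟨_, by simpa using hv k⟩
    · exact ⟨0, by simpa [h] using (coordFiltration B).one_mem⟩
  · rw [Finset.prod_eq_single i]
    · simp
    · intro c _ h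
      simp [h]
    · simp

theorem frobLift_box_of_mem {i : Fin n} (hi : i ∈ I) {u : F → F}
    (hu : FrobLift B (coordFiltration B) (w i) u) :
    FrobLift B (boxFiltration B I w) 1 (fun x => u (x i)) := fun e a =>
  let ⟨v, hv, hg⟩ := hu e a
  ⟨fun x => v (x i), fun x => hv (x i), good_box_of_mem hi hg⟩

theorem frobLift_box_of_notMem {i : Fin n} (hi : i ∉ I) {d : ℕ} {u : F → F}
    (hu : FrobLift B (coordFiltration B) d u) :
    FrobLift B (boxFiltration B I w) 0 (fun x => u (x i)) := fun e a =>
  let ⟨v, hv, hg⟩ := hu e a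
  ⟨fun x => v (x i), fun x => hv (x i), good_box_of_notMem hi hg⟩

theorem frobLift_subst (B : Module.Basis β (ZMod p) F) (I : Finset (Fin n))
    (f : Fin n → Polynomial F) (P : MvPolynomial (Fin n) F) :
    FrobLift B (boxFiltration B I fun i => pWeightDegreeUni p (f i)) (pWeightDegree p I P)
      (fun x => MvPolynomial.eval (fun i => (f i).eval (x i)) P) := by
  simp only [MvPolynomial.eval_eq']
  refine .sum _ fun m hm => ?_
  have h : ∀ i ∈ Finset.univ, FrobLift B (boxFiltration B I fun i => pWeightDegreeUni p (f i))
      (if i ∈ I then digitSum p (m i) else 0) (fun x => (f i).eval (x i) ^ m i) := by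
    intro i _
    split_ifs with hi
    · simpa using (frobLift_box_of_mem (w := fun i => pWeightDegreeUni p (f i)) hi
        (frobLift_eval B (f i))).pow (m i)
    · simpa using (frobLift_box_of_notMem (w := fun i => pWeightDegreeUni p (f i)) hi
        (frobLift_eval B (f i))).pow (m i)
  refine .mono ?_ ((FrobLift.const 0 (P.coeff m)).mul (FrobLift.prod Finset.univ h))
  simpa [pWeightDegree] using
    Finset.le_sup (f := fun m : Fin n →₀ ℕ => ∑ i ∈ I, digitSum p (m i)) hm

theorem div_sub_div_le_natSub {s l w q : ℕ} (hw : 0 < w) (hq : 0 < q) :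
    (s : ℚ) / w - l / q ≤ ((s - l * w / q : ℕ) : ℚ) := by
  have hw' : (1 : ℚ) ≤ w := by exact_mod_cast hw
  have hq' : (0 : ℚ) < q := by exact_mod_cast hq
  have h1 : (s : ℚ) - l * w / q ≤ ((s - l * w / q : ℕ) : ℚ) := by
    have h2 : (s : ℚ) ≤ ((s - l * w / q : ℕ) : ℚ) + ((l * w / q : ℕ) : ℚ) := by
      exact_mod_cast le_tsub_add
    have h3 : ((l * w / q : ℕ) : ℚ) ≤ l * w / q := by
      exact_mod_cast Nat.cast_div_le (α := ℚ) (m := l * w) (n := q)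
    linarith
  have h4 : (s : ℚ) / w - l / q = (s - l * w / q) / w := by
    field_simp
  rw [h4, div_le_iff₀ (by linarith)]
  exact h1.trans (le_mul_of_one_le_right (Nat.cast_nonneg _) hw')

theorem dvd_sum_of_mem_boxFiltration [Fintype F] (hw : ∀ i ∈ I, 0 < w i) {d : ℕ}
    {u : (Fin n → F) → ℤ} (hu : u ∈ (boxFiltration B I w).toFun d) :
    (p : ℤ) ^ ⌈(Fintype.card β : ℚ) * ∑ i ∈ I, 1 / (w i : ℚ) - d / ((p - 1 : ℕ) : ℚ)⌉₊ ∣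
      ∑ x, u x := by
  classical
  induction hu using Submodule.span_induction with
  | zero => simp
  | add u v _ _ hu hv => simpa [Finset.sum_add_distrib] using dvd_add hu hv
  | smul c u _ hu => simpa [← Finset.mul_sum] using hu.mul_left c
  | mem u hu =>
    obtain ⟨l, g, hl, hg, -, hu⟩ := hu
    have h1 : ∑ x, u x = ∏ i, ∑ y, g i y := by
      rw [Finset.prod_univ_sum, Fintype.piFinset_univ]
      simp [hu]
    have h2 : (p : ℤ) ^ (∑ i ∈ I, (Fintype.card β - l i * w i / (p - 1))) ∣
        ∏ i, ∑ y, g i y := by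
      -- Variables outside I carry no degree bound, so their factors are only used as integers.
      refine dvd_trans ?_ (Finset.prod_dvd_prod_of_subset I _ _ (Finset.subset_univ I))
      rw [← Finset.prod_pow_eq_pow_sum]
      exact Finset.prod_dvd_prod_of_dvd _ _ fun i hi => dvd_sum_of_mem_coordFiltration B (hg i hi)
    rw [h1]
    refine (pow_dvd_pow _ (Nat.ceil_le.2 ?_)).trans h2
    have hp : 0 < p - 1 := by have := (Fact.out : p.Prime).two_le; omega
    have h3 : ∑ i ∈ I, ((Fintype.card β : ℚ) / w i - l i / ((p - 1 : ℕ) : ℚ)) ≤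
        ∑ i ∈ I, ((Fintype.card β - l i * w i / (p - 1) : ℕ) : ℚ) :=
      Finset.sum_le_sum fun i hi => div_sub_div_le_natSub (hw i hi) hp
    rw [Finset.sum_sub_distrib, ← Finset.sum_div] at h3
    have h4 : (∑ i ∈ I, (l i : ℚ)) / ((p - 1 : ℕ) : ℚ) ≤ d / ((p - 1 : ℕ) : ℚ) := by
      gcongr
      exact_mod_cast hl
    have h5 : (Fintype.card β : ℚ) * ∑ i ∈ I, 1 / (w i : ℚ) =
        ∑ i ∈ I, (Fintype.card β : ℚ) / w i := by
      rw [Finset.mul_sum]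
      exact Finset.sum_congr rfl fun i _ => by ring
    push_cast
    linarith

end BoxFiltration

/-! ### Counting zeros and the main theorem -/

/-- If sums of functions of filtration degree `d` are divisible by `p ^ ⌈A - d / (p - 1)⌉`, then
the number of common zeros modulo `p` of good functions is divisible by a power of `p`. -/
theorem MulFiltration.Good.dvd_card_zeros {X τ : Type*} [Fintype X] [Fintype τ] {p : ℕ}
    (hp : p.Prime) (W : MulFiltration X) (A : ℚ)
    (hA : ∀ (d : ℕ) (u : X → ℤ), u ∈ W.toFun d →
      (p : ℤ) ^ ⌈A - d / ((p - 1 : ℕ) : ℚ)⌉₊ ∣ ∑ x, u x)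
    (v : τ → X → ℕ) (d : τ → ℕ) (hv : ∀ t, W.Good (d t) (v t)) (M : ℕ) (hM : 0 < M)
    (hd : ∀ t, d t ≤ M) :
    p ^ ⌈(A - ∑ t, (d t : ℚ)) / M⌉₊ ∣ {x | ∀ t, (v t x : ZMod p) = 0}.ncard := by
  classical
  obtain ⟨N, hN⟩ : ∃ N, ∀ t x, v t x < N :=
    ⟨(Finset.univ.sup fun t => Finset.univ.sup fun x => v t x) + 1, fun t x => Nat.lt_succ_of_le
      ((Finset.le_sup (f := fun x => v t x) (Finset.mem_univ x)).trans
        (Finset.le_sup (f := fun t => Finset.univ.sup fun x => v t x) (Finset.mem_univ t)))⟩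
  have hcount : (({x | ∀ t, (v t x : ZMod p) = 0}.ncard : ℕ) : ℤ) =
      ∑ κ ∈ Fintype.piFinset fun _ : τ => Finset.range N, (∏ t, fleckCoeff p (κ t)) *
        ∑ x, (∏ t, fun x => ((v t x).choose (κ t) : ℤ)) x := by
    have h1 : ∀ x, (∏ t, if (v t x : ZMod p) = 0 then (1 : ℤ) else 0) =
        if ∀ t, (v t x : ZMod p) = 0 then 1 else 0 := fun x => by
      simp [Finset.prod_ite_zero]
    rw [Set.ncard_eq_toFinset_card', Set.toFinset_ofPred, Finset.natCast_card_filter]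
    simp_rw [← h1, Finset.mul_sum]
    rw [Finset.sum_comm]
    refine Finset.sum_congr rfl fun x _ => ?_
    simp_rw [← sum_fleckCoeff_mul_choose p _ (hN _ x)]
    rw [Finset.prod_univ_sum]
    simp [Finset.prod_mul_distrib]
  rw [← Int.natCast_dvd_natCast, hcount, Nat.cast_pow]
  refine Finset.dvd_sum fun κ _ => ?_
  have hc : (p : ℤ) ^ (∑ t, (κ t - 1) / (p - 1)) ∣ ∏ t, fleckCoeff p (κ t) := by
    rw [← Finset.prod_pow_eq_pow_sum]
    refine Finset.prod_dvd_prod_of_dvd _ _ fun t _ => ?_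
    rcases Nat.eq_zero_or_pos (κ t) with h | h
    · simp [h]
    · refine pow_dvd_fleckCoeff hp _ _ ?_
      have := Nat.div_mul_le_self (κ t - 1) (p - 1)
      omega
  have hs := hA _ _ (W.prod_mem Finset.univ (fun t => κ t * d t)
    (fun t x => ((v t x).choose (κ t) : ℤ)) fun t _ => hv t (κ t))
  refine dvd_trans ?_ (mul_dvd_mul hc hs)
  rw [← pow_add]
  refine pow_dvd_pow _ (Nat.ceil_le.2 ?_)
  have hM' : (1 : ℚ) ≤ M := by exact_mod_cast hM
  rw [div_le_iff₀ (by linarith)]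
  have hp1 : 0 < p - 1 := by have := hp.two_le; omega
  have hp2 : (0 : ℚ) < ((p - 1 : ℕ) : ℚ) := by exact_mod_cast hp1
  set e := ⌈A - ((∑ t, κ t * d t : ℕ) : ℚ) / ((p - 1 : ℕ) : ℚ)⌉₊
  have he : A - ((∑ t, κ t * d t : ℕ) : ℚ) / ((p - 1 : ℕ) : ℚ) ≤ e := Nat.le_ceil _
  -- Up to rounding, κ_t is p - 1 times the power of p gained from c_{κ_t}; the rounding costs one
  -- extra d_t for each t, which is the subtracted ∑ d_t.
  have h1 : ∑ t, κ t * d t ≤ (∑ t, d t + (∑ t, (κ t - 1) / (p - 1)) * M) * (p - 1) := by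
    rw [Finset.sum_mul, ← Finset.sum_add_distrib, Finset.sum_mul]
    refine Finset.sum_le_sum fun t _ => ?_
    have h2 : κ t ≤ ((κ t - 1) / (p - 1) + 1) * (p - 1) := by
      have := Nat.lt_div_mul_add (a := κ t - 1) hp1
      rw [add_mul, one_mul]
      omega
    calc κ t * d t ≤ (((κ t - 1) / (p - 1) + 1) * (p - 1)) * d t := Nat.mul_le_mul_right _ h2
      _ = (d t + (κ t - 1) / (p - 1) * d t) * (p - 1) := by ring
      _ ≤ _ := by gcongr; exact hd t
  have h3 : ((∑ t, κ t * d t : ℕ) : ℚ) / ((p - 1 : ℕ) : ℚ) ≤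
      ∑ t, (d t : ℚ) + ((∑ t, (κ t - 1) / (p - 1) : ℕ) : ℚ) * M := by
    rw [div_le_iff₀ hp2]
    exact_mod_cast h1
  have h4 : (e : ℚ) ≤ e * M := le_mul_of_one_le_right (Nat.cast_nonneg _) hM'
  rw [Nat.cast_add, add_mul]
  linarith

theorem pWeightDegreeUni_pos {F : Type*} [Field F] {p : ℕ} (hp : 1 < p) {f : Polynomial F}
    (hf : 0 < f.natDegree) : 0 < pWeightDegreeUni p f := by
  have hf0 : f ≠ 0 := by rintro rfl; simp at hf
  exact (digitSum_pos hp hf).trans_le (Finset.le_sup (f := fun m => digitSum p m)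
    (Polynomial.natDegree_mem_support_of_nonzero hf0))

theorem mainTheorem3 {F : Type*} [Field F] [Finite F] (p s : ℕ) (hp : p.Prime)
    (hq : Nat.card F = p ^ s) (n r : ℕ)
    (P : Fin r → MvPolynomial (Fin n) F) (hP : ∀ j, P j ≠ 0)
    (I : Finset (Fin n)) (hI : I.Nonempty)
    (hmax : 0 < maxPWeightDegree p I P)
    (f : Fin n → Polynomial F) (hf : ∀ i ∈ I, 0 < (f i).natDegree)
    (hle : ∑ j, (pWeightDegree p I (P j) : ℚ) ≤ ∑ i ∈ I, 1 / (pWeightDegreeUni p (f i) : ℚ)) :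
    p ^ ⌈(s : ℚ) * (∑ i ∈ I, 1 / (pWeightDegreeUni p (f i) : ℚ)
        - ∑ j, (pWeightDegree p I (P j) : ℚ)) / (maxPWeightDegree p I P : ℚ)⌉₊
      ∣ (substSolutions P f).ncard := by
  have : Fact p.Prime := ⟨hp⟩
  have : Fintype F := Fintype.ofFinite F
  rw [Nat.card_eq_fintype_card] at hq
  have : CharP F p := charP_of_card_eq_prime_pow hq
  let _ : Algebra (ZMod p) F := ZMod.algebra F p
  have hs : Module.finrank (ZMod p) F = s := by
    have h := Module.card_eq_pow_finrank (K := ZMod p) (V := F)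
    rw [ZMod.card, hq] at h
    exact (Nat.pow_right_injective hp.two_le h).symm
  let B := Module.finBasis (ZMod p) F
  let W := boxFiltration B I fun i => pWeightDegreeUni p (f i)
  choose v hv hg using fun j => (frobLift_subst B I f (P j)).coordLift
  have key := MulFiltration.Good.dvd_card_zeros hp W
    ((s : ℚ) * ∑ i ∈ I, 1 / (pWeightDegreeUni p (f i) : ℚ))
    (fun d u hu => by
      have := dvd_sum_of_mem_boxFiltration
        (fun i hi => pWeightDegreeUni_pos hp.one_lt (hf i hi)) hu
      rwa [Fintype.card_fin, hs] at this)
    (fun t : Fin r × _ => v t.1 t.2) (fun t => pWeightDegree p I (P t.1)) (fun t => hg t.1 t.2)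
    (maxPWeightDegree p I P) hmax
    (fun t => Finset.le_sup (f := fun j => pWeightDegree p I (P j)) (Finset.mem_univ t.1))
  have hset : substSolutions P f = {x | ∀ t : Fin r × _, (v t.1 t.2 x : ZMod p) = 0} := by
    ext x
    simp only [substSolutions, Set.mem_ofPred_eq, Prod.forall, hv]
    refine forall_congr' fun j => ?_
    -- An element of F vanishes exactly when all its coordinates do.
    rw [← B.repr.map_eq_zero_iff, Finsupp.ext_iff]
    rfl
  rw [hset, mul_sub]
  convert key using 6
  -- Each P_j contributes s coordinate equations of equal degree, hence the factor s.
  rw [Fintype.sum_prod_type, Finset.mul_sum]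
  simp [hs]
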